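/- Let $k$ be a field and let $C$ be a coassociative counital coalgebra over $k$. A right coideal of $C$ is a subspace $N\subseteq C$ with $\Delta(N)\subseteq N\otimes C$, and $C$ is called a chain coalgebra if its right coideals are linearly ordered by inclusion. The dual algebra $C^*=\mathrm{Hom}_k(C,k)$ has the convolution product $(f*g)(x)=\sum f(x_1)g(x_2)$, where $\Delta(x)=\sum x_1\otimes x_2$, and unit $\varepsilon$. For a $k$-algebra $A$, the finite dual $A^\circ$ is the coalgebra of all linear forms $\varphi:A\to k$ that vanish on some two-sided ideal of $A$ of finite codimension, with counit $\varphi\mapsto\varphi(1)$ and comultiplication $\Delta(\varphi)=\sum\varphi_1\otimes\varphi_2$ determined by $\varphi(ab)=\sum\varphi_1(a)\varphi_2(b)$ for all $a,b\in A$. **Proposition.** Let $C$ be an infinite-dimensional chain coalgebra over $k$. Then $C$ is coreflexive, i.e. the evaluation map $c\mapsto(f\mapsto f(c))$ is an isomorphism of coalgebras $C\to(C^*)^\circ$. Moreover $C^*$ is a left noetherian chain domain, i.e. a left noetherian domain whose left ideals are linearly ordered by inclusion and whose right ideals are linearly ordered by inclusion. Hence $C$ is isomorphic, as a coalgebra,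 to the finite dual of a left noetherian chain domain, namely of $C^*$. -/

import Mathlib

open scoped TensorProduct

noncomputable section

/-! ### The finite dual of an algebra -/

/-- The finite dual of a `k`-algebra `A` as a subspace of the linear dual: the linear forms
on `A` that vanish on some two-sided ideal of finite codimension. -/
def finiteDualSubmodule (k A : Type*) [Field k] [Ring A] [Algebra k A] :
    Submodule k (A →ₗ[k] k) where
  carrier := {φ | ∃ I : Ideal A, I.IsTwoSided ∧ Module.Finite k (A ⧸ I) ∧ ∀ a ∈ I, φ a = 0}
  zero_mem' := ⟨⊤, inferInstance, inferInstance, fun _ _ => rfl⟩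
  add_mem' := by
    rintro φ ψ ⟨I, hI, hIf, hφ⟩ ⟨J, hJ, hJf, hψ⟩
    refine ⟨I ⊓ J, ⟨fun b h => ⟨hI.mul_mem_of_left b h.1, hJ.mul_mem_of_left b h.2⟩⟩, ?_, ?_⟩
    · let f : (A ⧸ (I ⊓ J)) →ₗ[A] (A ⧸ I) × (A ⧸ J) :=
        (Submodule.factor inf_le_left).prod (Submodule.factor inf_le_right)
      have hf : Function.Injective f := by
        rw [← LinearMap.ker_eq_bot, LinearMap.ker_eq_bot']
        intro x hx
        obtain ⟨a, rfl⟩ := Submodule.Quotient.mk_surjective _ x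
        have h1 : (Submodule.Quotient.mk a : A ⧸ I) = 0 := congrArg Prod.fst hx
        have h2 : (Submodule.Quotient.mk a : A ⧸ J) = 0 := congrArg Prod.snd hx
        rw [Submodule.Quotient.mk_eq_zero] at h1 h2 ⊢
        exact ⟨h1, h2⟩
      exact Module.Finite.of_injective (f.restrictScalars k) hf
    · intro a ha
      simp [hφ a ha.1, hψ a ha.2]
  smul_mem' := by
    rintro c φ ⟨I, hI, hIf, hφ⟩
    exact ⟨I, hI, hIf, fun a ha => by simp [hφ a ha]⟩

/-- The finite dual `A°` of a `k`-algebra `A`. -/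
def FiniteDual (k A : Type*) [Field k] [Ring A] [Algebra k A] : Type _ :=
  ↥(finiteDualSubmodule k A)

namespace FiniteDual

instance instAddCommGroup (k A : Type*) [Field k] [Ring A] [Algebra k A] :
    AddCommGroup (FiniteDual k A) :=
  inferInstanceAs (AddCommGroup ↥(finiteDualSubmodule k A))

instance instModule (k A : Type*) [Field k] [Ring A] [Algebra k A] : Module k (FiniteDual k A) :=
  inferInstanceAs (Module k ↥(finiteDualSubmodule k A))

/-- Elements of a tensor product are separated by a separating family of forms on one factor. -/
theorem tensor_eq_zero {k E F V : Type*} [Field k] [AddCommGroup E] [Module k E]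
    [AddCommGroup F] [Module k F] (ev : V → E →ₗ[k] k)
    (sep : ∀ e, (∀ v, ev v e = 0) → e = 0) (z : E ⊗[k] F)
    (h : ∀ v, (ev v).rTensor F z = 0) : z = 0 := by
  classical
  let b := Module.Basis.ofVectorSpace k F
  have key : ∀ v i, ∀ z : E ⊗[k] F, ev v (TensorProduct.equivFinsuppOfBasisRight b z i) =
      b.repr (TensorProduct.lid k F ((ev v).rTensor F z)) i := by
    intro v i z
    induction z with
    | zero => simp
    | add x y hx hy => simp [hx, hy]
    | tmul x y => simp [mul_comm]
  apply (TensorProduct.equivFinsuppOfBasisRight (M := E) b).injective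
  rw [map_zero]
  ext i
  apply sep
  intro v
  rw [key, h]
  simp

variable {k A : Type*} [Field k] [Ring A] [Algebra k A]

/-- Evaluation of a linear form in `A°` at an element of `A`. -/
def ev (a : A) : FiniteDual k A →ₗ[k] k := LinearMap.applyₗ a ∘ₗ (finiteDualSubmodule k A).subtype

@[simp] theorem ev_apply (a : A) (φ : FiniteDual k A) : ev a φ = φ.1 a := rfl

theorem eq_zero_of_ev (φ : FiniteDual k A) (h : ∀ a : A, ev a φ = 0) : φ = 0 :=
  Subtype.ext (LinearMap.ext h)

/-- `φ ⊗ ψ ↦ φ a * ψ b`. -/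
def pair (a b : A) : FiniteDual k A ⊗[k] FiniteDual k A →ₗ[k] k :=
  LinearMap.mul' k k ∘ₗ TensorProduct.map (ev a) (ev b)

@[simp] theorem pair_tmul (a b : A) (φ ψ : FiniteDual k A) :
    pair a b (φ ⊗ₜ[k] ψ) = φ.1 a * ψ.1 b := rfl

theorem pair_eq_ev (a b : A) (z : FiniteDual k A ⊗[k] FiniteDual k A) :
    pair a b z = ev b (TensorProduct.lid k _ ((ev a).rTensor _ z)) := by
  induction z with
  | zero => simp only [map_zero]
  | add x y hx hy => simp only [map_add, hx, hy]
  | tmul x y => simp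

theorem pair_ext {z w : FiniteDual k A ⊗[k] FiniteDual k A}
    (h : ∀ a b, pair a b z = pair a b w) : z = w := by
  rw [← sub_eq_zero]
  refine tensor_eq_zero (ev (k := k) (A := A)) eq_zero_of_ev _ fun a => ?_
  apply (TensorProduct.lid k (FiniteDual k A)).injective
  rw [map_zero]
  refine eq_zero_of_ev _ fun b => ?_
  rw [← pair_eq_ev, map_sub, h, sub_self]

/-- `φ ⊗ (ψ ⊗ χ) ↦ φ a * (ψ b * χ c)`. -/
def pair₃ (a b c : A) :
    FiniteDual k A ⊗[k] (FiniteDual k A ⊗[k] FiniteDual k A) →ₗ[k] k :=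
  LinearMap.mul' k k ∘ₗ TensorProduct.map (ev a) (pair b c)

@[simp] theorem pair₃_tmul (a b c : A) (φ : FiniteDual k A)
    (w : FiniteDual k A ⊗[k] FiniteDual k A) :
    pair₃ a b c (φ ⊗ₜ[k] w) = φ.1 a * pair b c w := rfl

theorem pair₃_ext {z w : FiniteDual k A ⊗[k] (FiniteDual k A ⊗[k] FiniteDual k A)}
    (h : ∀ a b c, pair₃ a b c z = pair₃ a b c w) : z = w := by
  have key : ∀ a b c, ∀ z : FiniteDual k A ⊗[k] (FiniteDual k A ⊗[k] FiniteDual k A),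
      pair b c (TensorProduct.lid k _ ((ev a).rTensor _ z)) = pair₃ a b c z := by
    intro a b c z
    induction z with
    | zero => simp
    | add x y hx hy => simp [hx, hy]
    | tmul x y => simp
  rw [← sub_eq_zero]
  refine tensor_eq_zero (ev (k := k) (A := A)) eq_zero_of_ev _ fun a => ?_
  apply (TensorProduct.lid k (FiniteDual k A ⊗[k] FiniteDual k A)).injective
  rw [map_zero]
  refine pair_ext fun b c => ?_
  rw [key, map_sub, h, sub_self, map_zero]

theorem exists_comul (φ : FiniteDual k A) :
    ∃ z : FiniteDual k A ⊗[k] FiniteDual k A, ∀ a b, pair a b z = φ.1 (a * b) := by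
  obtain ⟨φ, I, hI, hIf, hφ⟩ := φ
  let π : A →ₗ[k] A ⧸ I := (Ideal.Quotient.mkₐ k I).toLinearMap
  let φ' : (A ⧸ I) →ₗ[k] k := (I.restrictScalars k).liftQ φ hφ
  have hφ' : ∀ a, φ' (π a) = φ a := fun a => rfl
  let p : Module.Dual k (A ⧸ I) →ₗ[k] FiniteDual k A :=
    LinearMap.codRestrict (finiteDualSubmodule k A) π.dualMap fun f => ⟨I, hI, hIf, fun a ha => by
      have : π a = 0 := Ideal.Quotient.eq_zero_iff_mem.2 ha
      simp [this]⟩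
  let w := (TensorProduct.dualDistribEquiv k (A ⧸ I) (A ⧸ I)).symm (φ' ∘ₗ LinearMap.mul' k _)
  have hw : TensorProduct.dualDistrib k (A ⧸ I) (A ⧸ I) w = φ' ∘ₗ LinearMap.mul' k _ :=
    (TensorProduct.dualDistribEquiv k (A ⧸ I) (A ⧸ I)).apply_symm_apply _
  refine ⟨TensorProduct.map p p w, fun a b => ?_⟩
  have key : ∀ w, pair a b (TensorProduct.map p p w) =
      TensorProduct.dualDistrib k (A ⧸ I) (A ⧸ I) w (π a ⊗ₜ π b) := by
    intro w
    induction w with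
    | zero => simp
    | add x y hx hy => simp [hx, hy]
    | tmul x y => exact (TensorProduct.dualDistrib_apply ..).symm
  rw [key, hw]
  change φ' (π a * π b) = φ (a * b)
  rw [← hφ']
  exact congrArg φ' (map_mul (Ideal.Quotient.mkₐ k I) a b).symm

/-- The comultiplication of `A°`: `Δ φ` is the unique element `∑ φ₁ ⊗ φ₂` of `A° ⊗ A°` with
`∑ φ₁ a * φ₂ b = φ (a * b)` for all `a` and `b`. -/
def comulMap : FiniteDual k A →ₗ[k] FiniteDual k A ⊗[k] FiniteDual k A where
  toFun φ := (exists_comul φ).choose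
  map_add' φ ψ := pair_ext fun a b => by
    simp only [map_add, (exists_comul _).choose_spec]
    rfl
  map_smul' c φ := pair_ext fun a b => by
    simp only [map_smul, (exists_comul _).choose_spec]
    rfl

theorem pair_comulMap (a b : A) (φ : FiniteDual k A) : pair a b (comulMap φ) = φ.1 (a * b) :=
  (exists_comul φ).choose_spec a b

theorem pair₃_assoc (a b c : A) (z : FiniteDual k A ⊗[k] FiniteDual k A) :
    pair₃ a b c (TensorProduct.assoc k _ _ _ (comulMap.rTensor _ z)) = pair (a * b) c z := by
  have key : ∀ (w : FiniteDual k A ⊗[k] FiniteDual k A) (ψ : FiniteDual k A),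
      pair₃ a b c (TensorProduct.assoc k _ _ _ (w ⊗ₜ[k] ψ)) = pair a b w * ψ.1 c := by
    intro w ψ
    induction w with
    | zero => simp
    | add x y hx hy => simp [TensorProduct.add_tmul, hx, hy, add_mul]
    | tmul x y => simp [mul_assoc]
  induction z with
  | zero => simp
  | add x y hx hy => simp [hx, hy]
  | tmul x y => simp [key, pair_comulMap]

theorem pair₃_lTensor (a b c : A) (z : FiniteDual k A ⊗[k] FiniteDual k A) :
    pair₃ a b c (comulMap.lTensor _ z) = pair a (b * c) z := by
  induction z with
  | zero => simp
  | add x y hx hy => simp [hx, hy]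
  | tmul x y => simp [pair_comulMap]

/-- The coalgebra structure of the finite dual, with counit `φ ↦ φ 1`. -/
instance instCoalgebra : Coalgebra k (FiniteDual k A) where
  comul := comulMap
  counit := ev 1
  coassoc := LinearMap.ext fun φ => pair₃_ext fun a b c => by
    simp only [LinearMap.comp_apply, LinearEquiv.coe_coe, pair₃_assoc, pair₃_lTensor,
      pair_comulMap, mul_assoc]
  rTensor_counit_comp_comul := LinearMap.ext fun φ => by
    apply (TensorProduct.lid k (FiniteDual k A)).injective
    rw [← sub_eq_zero]
    refine eq_zero_of_ev _ fun a => ?_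
    rw [map_sub, LinearMap.comp_apply, ← pair_eq_ev, pair_comulMap]
    simp
  lTensor_counit_comp_comul := LinearMap.ext fun φ => by
    have key : ∀ (a : A) (z : FiniteDual k A ⊗[k] FiniteDual k A),
        ev a (TensorProduct.rid k _ ((ev 1).lTensor _ z)) = pair a 1 z := by
      intro a z
      induction z with
      | zero => simp only [map_zero]
      | add x y hx hy => simp only [map_add, hx, hy]
      | tmul x y => simp [mul_comm]
    apply (TensorProduct.rid k (FiniteDual k A)).injective
    rw [← sub_eq_zero]
    refine eq_zero_of_ev _ fun a => ?_
    rw [map_sub, LinearMap.comp_apply, key, pair_comulMap]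
    simp

end FiniteDual

/-! ### Coalgebras -/

/-- The dual algebra `C*` of a coalgebra `C`, with the convolution product
`(f * g) x = ∑ f x₁ * g x₂` and unit the counit. -/
abbrev DualAlgebra (k C : Type*) [Field k] [AddCommGroup C] [Module k C] [Coalgebra k C] :
    Type _ :=
  WithConv (C →ₗ[k] k)

section Coalgebras

variable (k : Type*) {C : Type*} [Field k] [AddCommGroup C] [Module k C] [Coalgebra k C]

/-- A right coideal of `C`, that is a right subcomodule of `C`: a subspace `N` with
`Δ N ⊆ N ⊗ C`. -/
def IsRightCoideal (N : Submodule k C) : Prop :=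
  ∀ x ∈ N, Coalgebra.comul (R := k) x ∈ LinearMap.range (N.subtype.rTensor C)

variable (C)

/-- A chain coalgebra: the right coideals are linearly ordered by inclusion. -/
def IsChainCoalgebra : Prop :=
  ∀ N L : Submodule k C, IsRightCoideal k N → IsRightCoideal k L → N ≤ L ∨ L ≤ N

/-- A coalgebra `C` is coreflexive if it is naturally isomorphic to `(C*)°`: the evaluation map
`c ↦ (f ↦ f c)` is an isomorphism of coalgebras from `C` onto the finite dual of `C*`. -/
def IsCoreflexive : Prop :=
  ∃ e : C ≃ₗc[k] FiniteDual k (DualAlgebra k C),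
    ∀ (c : C) (f : DualAlgebra k C), (e c).1 f = f c

end Coalgebras

/-- A left noetherian chain domain: a domain whose left ideals are linearly ordered by inclusion,
whose right ideals are linearly ordered by inclusion, and whose left ideals satisfy the ascending
chain condition. -/
structure IsLeftNoetherianChainDomain (A : Type*) [Ring A] : Prop where
  isDomain : IsDomain A
  left_total : ∀ I J : Submodule A A, I ≤ J ∨ J ≤ I
  right_total : ∀ I J : Submodule Aᵐᵒᵖ A, I ≤ J ∨ J ≤ I
  left_noetherian : IsNoetherian A A

end

/-! ### Linear algebra -/

/-! Right coideals are the subspaces stable under `f ⇀ c`. Since `c ↼ f` commutes with this action,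
its kernel and image are right coideals. Every `c` lies in the finite-dimensional right coideal `C*
⇀ c`, so in a chain coalgebra proper right coideals are finite-dimensional, and each is determined
by its dimension. Hence for `f ≠ 0` the map `hitRight f` has finite-dimensional kernel and, `C`
being infinite-dimensional, is onto. So products of nonzero functionals are nonzero, and `d f = dim
ker (hitRight f)` is additive on them.

By duality `f C*` is the orthogonal of `ker (hitRight f)`, so inclusion of principal right ideals
reverses inclusion of right coideals: the right ideals form a chain.

For left ideals one needs `f C* = C* f`. Finite-dimensional right coideals are also stable under
`↼`, which gives `C* f ⊆ f C*`, that is `a f = f σ(a)` with `σ` linear. Additivity of `d` shows that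
`a` and `σ(a)` have the same kernel, so `σ` induces a bijection on `N*` for every finite-dimensional
right coideal `N`. As `C* f` is an orthogonal, this surjectivity on each `N*` suffices for `f C* ⊆
C* f`. Left ideals then form a chain and, by minimizing `d`, are principal.

Finally, an ideal of finite codimension contains some `f C*` with `f ≠ 0`, so a form vanishing on it
is the evaluation at a vector of `ker (hitRight f)`. -/

theorem LinearMap.finrank_ker_comp_of_surjective {k U V W : Type*} [Field k] [AddCommGroup U]
    [Module k U] [AddCommGroup V] [Module k V] [AddCommGroup W] [Module k W]
    (f : U →ₗ[k] V) (g : V →ₗ[k] W) (hf : Function.Surjective f)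
    [FiniteDimensional k (LinearMap.ker (g ∘ₗ f))] :
    Module.finrank k (LinearMap.ker (g ∘ₗ f)) =
      Module.finrank k (LinearMap.ker g) + Module.finrank k (LinearMap.ker f) := by
  let φ : LinearMap.ker (g ∘ₗ f) →ₗ[k] LinearMap.ker g :=
    f.restrict fun x hx => by simpa using hx
  have hφ : LinearMap.range φ = ⊤ := by
    rw [LinearMap.range_eq_top]
    rintro ⟨y, hy⟩
    obtain ⟨x, rfl⟩ := hf y
    exact ⟨⟨x, by simpa using hy⟩, rfl⟩
  have hker : LinearMap.ker φ = (LinearMap.ker f).comap (LinearMap.ker (g ∘ₗ f)).subtype := by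
    ext x
    rw [LinearMap.mem_ker, Submodule.mem_comap, LinearMap.mem_ker, Subtype.ext_iff]
    rfl
  have h := LinearMap.finrank_range_add_finrank_ker φ
  rw [hφ, finrank_top, hker,
    (Submodule.comapSubtypeEquivOfLe (LinearMap.ker_le_ker_comp f g)).finrank_eq] at h
  exact h.symm

/-- Both images are isomorphic to the same quotient of `V`, so their dimensions agree; only `W` has
to be finite-dimensional. -/
theorem LinearMap.surjective_of_ker_eq {k V W : Type*} [Field k] [AddCommGroup V]
    [Module k V] [AddCommGroup W] [Module k W] [FiniteDimensional k W] (p q : V →ₗ[k] W)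
    (hp : Function.Surjective p) (h : LinearMap.ker p = LinearMap.ker q) :
    Function.Surjective q := by
  rw [← LinearMap.range_eq_top]
  apply Submodule.eq_top_of_finrank_eq
  rw [← q.quotKerEquivRange.finrank_eq, ← (Submodule.quotEquivOfEq _ _ h).finrank_eq,
    p.quotKerEquivRange.finrank_eq, LinearMap.range_eq_top.2 hp, finrank_top]

/-- Submodules are linearly ordered as soon as the cyclic ones are. -/
theorem Submodule.le_total_of_mem_span_singleton {R M : Type*} [Ring R] [AddCommGroup M]
    [Module R M] (h : ∀ x y : M, (∃ a : R, y = a • x) ∨ ∃ a : R, x = a • y)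
    (I J : Submodule R M) : I ≤ J ∨ J ≤ I := by
  by_contra! hIJ
  obtain ⟨x, hxI, hxJ⟩ := Set.not_subset.1 hIJ.1
  obtain ⟨y, hyJ, hyI⟩ := Set.not_subset.1 hIJ.2
  rcases h x y with ⟨a, rfl⟩ | ⟨a, rfl⟩
  · exact hyI (I.smul_mem a hxI)
  · exact hxJ (J.smul_mem a hyJ)

noncomputable section

namespace DualAlgebra

variable {k C : Type*} [Field k] [AddCommGroup C] [Module k C] [Coalgebra k C]

/-! ### The two actions of the dual algebra on the coalgebra -/

/-- The left action `f ⇀ c = ∑ c₁ f(c₂)` of `C*` on `C`. -/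
def hitLeft (f : DualAlgebra k C) : C →ₗ[k] C :=
  TensorProduct.rid k C ∘ₗ f.ofConv.lTensor C ∘ₗ Coalgebra.comul

/-- The right action `c ↼ f = ∑ f(c₁) c₂` of `C*` on `C`. -/
def hitRight (f : DualAlgebra k C) : C →ₗ[k] C :=
  TensorProduct.lid k C ∘ₗ f.ofConv.rTensor C ∘ₗ Coalgebra.comul

theorem apply_hitLeft (f g : DualAlgebra k C) (x : C) : f (hitLeft g x) = (f * g) x := by
  have key : ∀ z : C ⊗[k] C, f (TensorProduct.rid k C (g.ofConv.lTensor C z)) =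
      LinearMap.mul' k k (TensorProduct.map f.ofConv g.ofConv z) := by
    intro z
    induction z with
    | zero => simp
    | add x y hx hy => simp [hx, hy]
    | tmul x y => simp [mul_comm]
  exact key _

theorem apply_hitRight (f g : DualAlgebra k C) (x : C) : g (hitRight f x) = (f * g) x := by
  have key : ∀ z : C ⊗[k] C, g (TensorProduct.lid k C (f.ofConv.rTensor C z)) =
      LinearMap.mul' k k (TensorProduct.map f.ofConv g.ofConv z) := by
    intro z
    induction z with
    | zero => simp
    | add x y hx hy => simp [hx, hy]
    | tmul x y => simp
  exact key _

/-- Functionals separate points, which reduces the identities between the two actions to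
associativity of convolution. -/
theorem eq_of_forall_apply_eq {x y : C} (h : ∀ f : DualAlgebra k C, f x = f y) : x = y := by
  rw [← sub_eq_zero, ← Module.forall_dual_apply_eq_zero_iff k]
  intro f
  rw [map_sub, sub_eq_zero]
  exact h (WithConv.toConv f)

theorem ext_apply {f g : DualAlgebra k C} (h : ∀ x, f x = g x) : f = g :=
  WithConv.ext (LinearMap.ext h)

theorem hitLeft_one (x : C) : hitLeft (1 : DualAlgebra k C) x = x :=
  eq_of_forall_apply_eq fun f => by rw [apply_hitLeft, mul_one]

theorem hitLeft_hitLeft (f g : DualAlgebra k C) (x : C) :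
    hitLeft f (hitLeft g x) = hitLeft (f * g) x :=
  eq_of_forall_apply_eq fun a : DualAlgebra k C => by simp only [apply_hitLeft, mul_assoc]

theorem hitRight_hitRight (f g : DualAlgebra k C) (x : C) :
    hitRight g (hitRight f x) = hitRight (f * g) x :=
  eq_of_forall_apply_eq fun a : DualAlgebra k C => by simp only [apply_hitRight, mul_assoc]

theorem hitLeft_hitRight (f g : DualAlgebra k C) (x : C) :
    hitLeft f (hitRight g x) = hitRight g (hitLeft f x) :=
  eq_of_forall_apply_eq fun a : DualAlgebra k C => by simp only [apply_hitLeft, apply_hitRight, mul_assoc]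

theorem one_hitRight (f : DualAlgebra k C) (x : C) :
    (1 : DualAlgebra k C) (hitRight f x) = f x := by
  rw [apply_hitRight, mul_one]

theorem hitRight_eq_zero_iff (f : DualAlgebra k C) : hitRight f = 0 ↔ f = 0 := by
  constructor
  · intro h
    refine ext_apply fun x => ?_
    rw [← one_hitRight, h]
    simp
  · rintro rfl
    ext x
    refine eq_of_forall_apply_eq (k := k) fun a => ?_
    rw [apply_hitRight, zero_mul]
    simp

/-- The linear map `f ↦ f ⇀ c`. -/
def orbitMap (c : C) : DualAlgebra k C →ₗ[k] C where
  toFun f := hitLeft f c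
  map_add' f g := eq_of_forall_apply_eq fun a : DualAlgebra k C => by
    rw [map_add, apply_hitLeft, apply_hitLeft, apply_hitLeft, mul_add]; rfl
  map_smul' r f := eq_of_forall_apply_eq fun a : DualAlgebra k C => by
    rw [RingHom.id_apply, map_smul, apply_hitLeft, apply_hitLeft, mul_smul_comm]; rfl

/-! ### Right coideals are the subspaces stable under the left action -/

theorem tensor_eq_zero_of_lTensor {E F : Type*} [AddCommGroup E] [Module k E]
    [AddCommGroup F] [Module k F] (z : E ⊗[k] F)
    (h : ∀ f : F →ₗ[k] k, f.lTensor E z = 0) : z = 0 := by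
  apply (TensorProduct.comm k E F).injective
  rw [map_zero]
  refine FiniteDual.tensor_eq_zero (fun f : F →ₗ[k] k => f)
    (fun e he => (Module.forall_dual_apply_eq_zero_iff k e).1 he) _ fun f => ?_
  have key : ∀ z : E ⊗[k] F, f.rTensor E (TensorProduct.comm k E F z) =
      TensorProduct.comm k E k (f.lTensor E z) := by
    intro z
    induction z with
    | zero => simp
    | add x y hx hy => simp [hx, hy]
    | tmul x y => simp
  rw [key, h, map_zero]

theorem isRightCoideal_iff (N : Submodule k C) :
    IsRightCoideal k N ↔ ∀ f : DualAlgebra k C, ∀ x ∈ N, hitLeft f x ∈ N := by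
  constructor
  · intro h f x hx
    obtain ⟨z, hz⟩ := h x hx
    have key : ∀ z : N ⊗[k] C,
        TensorProduct.rid k C (f.ofConv.lTensor C (N.subtype.rTensor C z)) ∈ N := by
      intro z
      induction z with
      | zero => simp
      | add x y hx hy =>
        simp only [map_add]
        exact N.add_mem hx hy
      | tmul x y =>
        simp only [LinearMap.rTensor_tmul, LinearMap.lTensor_tmul, TensorProduct.rid_tmul]
        exact N.smul_mem _ x.2
    have := key z
    rw [hz] at this
    exact this
  · intro h x hx
    -- `N ⊗ C` is the kernel of `C ⊗ C → (C/N) ⊗ C`, and the image of `Δ x` there vanishes once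
    -- every `id ⊗ f` kills it.
    have hex : Function.Exact (N.subtype.rTensor C) (N.mkQ.rTensor C) :=
      rTensor_exact C (LinearMap.exact_subtype_mkQ N) N.mkQ_surjective
    refine (hex _).1 (tensor_eq_zero_of_lTensor _ fun f => ?_)
    apply (TensorProduct.rid k (C ⧸ N)).injective
    have key : ∀ z : C ⊗[k] C, TensorProduct.rid k (C ⧸ N)
        (f.lTensor (C ⧸ N) (N.mkQ.rTensor C z)) =
          N.mkQ (TensorProduct.rid k C (f.lTensor C z)) := by
      intro z
      induction z with
      | zero => simp
      | add x y hx hy => simp only [map_add, hx, hy]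
      | tmul x y => simp
    rw [key, map_zero, Submodule.mkQ_apply, Submodule.Quotient.mk_eq_zero]
    exact h (WithConv.toConv f) x hx

theorem isRightCoideal_ker_hitRight (f : DualAlgebra k C) :
    IsRightCoideal k (LinearMap.ker (hitRight f)) := by
  rw [isRightCoideal_iff]
  intro g x hx
  rw [LinearMap.mem_ker] at hx ⊢
  rw [← hitLeft_hitRight, hx, map_zero]

theorem IsRightCoideal.map_hitRight {N : Submodule k C} (hN : IsRightCoideal k N)
    (f : DualAlgebra k C) : IsRightCoideal k (N.map (hitRight f)) := by
  rw [isRightCoideal_iff] at hN ⊢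
  rintro g _ ⟨x, hx, rfl⟩
  exact ⟨hitLeft g x, hN g x hx, (hitLeft_hitRight g f x).symm⟩

theorem isRightCoideal_range_orbitMap (c : C) :
    IsRightCoideal k (LinearMap.range (orbitMap (k := k) c)) := by
  rw [isRightCoideal_iff]
  rintro g _ ⟨f, rfl⟩
  exact ⟨g * f, (hitLeft_hitLeft g f c).symm⟩

theorem mem_range_orbitMap (c : C) : c ∈ LinearMap.range (orbitMap (k := k) c) :=
  ⟨1, hitLeft_one c⟩

/-- `Δ c` is a finite sum of pure tensors, and every `f ⇀ c` lies in the span of their left factors.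
-/
theorem finiteDimensional_range_orbitMap (c : C) :
    FiniteDimensional k (LinearMap.range (orbitMap (k := k) c)) := by
  have key : ∀ z : C ⊗[k] C, ∃ W : Submodule k C, FiniteDimensional k W ∧
      ∀ f : C →ₗ[k] k, TensorProduct.rid k C (f.lTensor C z) ∈ W := by
    intro z
    induction z with
    | zero => exact ⟨⊥, inferInstance, by simp⟩
    | add x y hx hy =>
      obtain ⟨V, hV, hVx⟩ := hx
      obtain ⟨W, hW, hWy⟩ := hy
      refine ⟨V ⊔ W, inferInstance, fun f => ?_⟩
      rw [map_add, map_add]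
      exact add_mem (Submodule.mem_sup_left (hVx f)) (Submodule.mem_sup_right (hWy f))
    | tmul x y =>
      refine ⟨k ∙ x, inferInstance, fun f => ?_⟩
      rw [LinearMap.lTensor_tmul, TensorProduct.rid_tmul]
      exact Submodule.smul_mem _ _ (Submodule.mem_span_singleton_self x)
  obtain ⟨W, hW, h⟩ := key (Coalgebra.comul c)
  refine Submodule.finiteDimensional_of_le (S₂ := W) ?_
  rintro _ ⟨f, rfl⟩
  exact h f.ofConv

/-! ### Principal one-sided ideals -/

/-- The right ideal `f C*` is the orthogonal of the kernel of `c ↦ c ↼ f`. -/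
theorem exists_eq_mul_iff (f g : DualAlgebra k C) :
    (∃ a, g = f * a) ↔ LinearMap.ker (hitRight f) ≤ LinearMap.ker g.ofConv := by
  constructor
  · rintro ⟨a, rfl⟩ x hx
    rw [LinearMap.mem_ker] at hx ⊢
    rw [← apply_hitRight, hx, map_zero]
  · intro h
    have : g.ofConv ∈ LinearMap.range (hitRight f).dualMap := by
      rw [LinearMap.range_dualMap_eq_dualAnnihilator_ker, Submodule.mem_dualAnnihilator]
      exact fun x hx => h hx
    obtain ⟨a, ha⟩ := this
    refine ⟨WithConv.toConv a, ext_apply fun x => ?_⟩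
    rw [← apply_hitRight, ← ha]
    rfl

/-- The left ideal `C* f` is the orthogonal of the kernel of `c ↦ f ⇀ c`. -/
theorem exists_eq_mul_iff' (f g : DualAlgebra k C) :
    (∃ a, g = a * f) ↔ LinearMap.ker (hitLeft f) ≤ LinearMap.ker g.ofConv := by
  constructor
  · rintro ⟨a, rfl⟩ x hx
    rw [LinearMap.mem_ker] at hx ⊢
    rw [← apply_hitLeft, hx, map_zero]
  · intro h
    have : g.ofConv ∈ LinearMap.range (hitLeft f).dualMap := by
      rw [LinearMap.range_dualMap_eq_dualAnnihilator_ker, Submodule.mem_dualAnnihilator]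
      exact fun x hx => h hx
    obtain ⟨a, ha⟩ := this
    refine ⟨WithConv.toConv a, ext_apply fun x => ?_⟩
    rw [← apply_hitLeft, ← ha]
    rfl

/-- A functional vanishes on the right coideal `N` exactly if `c ↦ c ↼ f` does. -/
theorem le_ker_hitRight_iff {N : Submodule k C} (hN : IsRightCoideal k N) (f : DualAlgebra k C) :
    N ≤ LinearMap.ker (hitRight f) ↔ N ≤ LinearMap.ker f.ofConv := by
  constructor
  · intro h x hx
    rw [LinearMap.mem_ker, ← one_hitRight, LinearMap.mem_ker.1 (h hx), map_zero]
  · intro h x hx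
    rw [LinearMap.mem_ker]
    refine eq_of_forall_apply_eq (k := k) fun a => ?_
    rw [apply_hitRight, ← apply_hitLeft, map_zero]
    exact h ((isRightCoideal_iff N).1 hN a x hx)

/-! ### Right coideals of a chain coalgebra -/

/-- For `c ∉ N` the chain condition forces `N` into the finite-dimensional coideal `C* ⇀ c`. -/
theorem finiteDimensional_of_isRightCoideal (hC : IsChainCoalgebra k C) {N : Submodule k C}
    (hN : IsRightCoideal k N) (hne : N ≠ ⊤) : FiniteDimensional k N := by
  obtain ⟨c, hc⟩ : ∃ c, c ∉ N := by
    by_contra! h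
    exact hne (eq_top_iff.2 fun c _ => h c)
  have := finiteDimensional_range_orbitMap (k := k) c
  rcases hC N _ hN (isRightCoideal_range_orbitMap c) with h | h
  · exact Submodule.finiteDimensional_of_le h
  · exact absurd (h (mem_range_orbitMap c)) hc

theorem eq_of_finrank_eq (hC : IsChainCoalgebra k C) {N L : Submodule k C}
    (hN : IsRightCoideal k N) (hL : IsRightCoideal k L) [FiniteDimensional k N]
    [FiniteDimensional k L] (h : Module.finrank k N = Module.finrank k L) : N = L := by
  rcases hC N L hN hL with hle | hle
  · exact Submodule.eq_of_le_of_finrank_eq hle h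
  · exact (Submodule.eq_of_le_of_finrank_eq hle h.symm).symm

/-- The finite-dimensional right coideals of a chain coalgebra are subcoalgebras. -/
theorem map_hitRight_le (hC : IsChainCoalgebra k C) {N : Submodule k C}
    (hN : IsRightCoideal k N) [FiniteDimensional k N] (f : DualAlgebra k C) :
    N.map (hitRight f) ≤ N := by
  rcases hC _ _ (IsRightCoideal.map_hitRight hN f) hN with h | h
  · exact h
  -- The image has dimension at most that of `N`, so it cannot contain `N` strictly.
  · exact (Submodule.eq_of_le_of_finrank_le h (Submodule.finrank_map_le _ _)).ge

/-! ### The operator of a nonzero functional: kernel, surjectivity, additivity -/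

theorem finiteDimensional_ker_hitRight (hC : IsChainCoalgebra k C) {f : DualAlgebra k C}
    (hf : f ≠ 0) : FiniteDimensional k (LinearMap.ker (hitRight f)) :=
  finiteDimensional_of_isRightCoideal hC (isRightCoideal_ker_hitRight f) fun h =>
    hf ((hitRight_eq_zero_iff f).1 (LinearMap.ker_eq_top.1 h))

/-- A proper image would be a finite-dimensional right coideal; with the finite-dimensional kernel,
this would make `C` finite-dimensional. -/
theorem hitRight_surjective (hC : IsChainCoalgebra k C) (hinf : ¬ FiniteDimensional k C)
    {f : DualAlgebra k C} (hf : f ≠ 0) : Function.Surjective (hitRight f) := by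
  rw [← LinearMap.range_eq_top]
  by_contra hne
  have htop : IsRightCoideal k (⊤ : Submodule k C) := by
    rw [isRightCoideal_iff]
    exact fun _ _ _ => Submodule.mem_top
  have hco : IsRightCoideal k (LinearMap.range (hitRight f)) := by
    rw [LinearMap.range_eq_map]
    exact IsRightCoideal.map_hitRight htop f
  have h1 := finiteDimensional_of_isRightCoideal hC hco hne
  have h2 := finiteDimensional_ker_hitRight hC hf
  have h3 : FiniteDimensional k (C ⧸ LinearMap.ker (hitRight f)) :=
    Module.Finite.equiv (hitRight f).quotKerEquivRange.symm
  exact hinf (Module.Finite.of_submodule_quotient (LinearMap.ker (hitRight f)))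

theorem hitRight_mul (f g : DualAlgebra k C) : hitRight (f * g) = hitRight g ∘ₗ hitRight f :=
  LinearMap.ext fun x => (hitRight_hitRight f g x).symm

theorem noZeroDivisors (hC : IsChainCoalgebra k C) (hinf : ¬ FiniteDimensional k C) :
    NoZeroDivisors (DualAlgebra k C) where
  eq_zero_or_eq_zero_of_mul_eq_zero {f g} h := by
    by_contra! hne
    apply hne.2
    rw [← hitRight_eq_zero_iff, ← LinearMap.cancel_right (hitRight_surjective hC hinf hne.1),
      ← hitRight_mul, h, LinearMap.zero_comp, hitRight_eq_zero_iff]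

theorem nontrivial_of_not_finiteDimensional (hinf : ¬ FiniteDimensional k C) :
    Nontrivial (DualAlgebra k C) := by
  by_contra h
  rw [not_nontrivial_iff_subsingleton] at h
  have : Subsingleton C :=
    ⟨fun x y => eq_of_forall_apply_eq (k := k) fun f => by rw [Subsingleton.elim f 0]; simp⟩
  exact hinf inferInstance

theorem isDomain (hC : IsChainCoalgebra k C) (hinf : ¬ FiniteDimensional k C) :
    IsDomain (DualAlgebra k C) := by
  have := noZeroDivisors hC hinf
  have := nontrivial_of_not_finiteDimensional hinf
  exact NoZeroDivisors.to_isDomain _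

theorem finrank_ker_hitRight_mul (hC : IsChainCoalgebra k C) (hinf : ¬ FiniteDimensional k C)
    {f g : DualAlgebra k C} (hf : f ≠ 0) (hg : g ≠ 0) :
    Module.finrank k (LinearMap.ker (hitRight (f * g))) =
      Module.finrank k (LinearMap.ker (hitRight g)) +
        Module.finrank k (LinearMap.ker (hitRight f)) := by
  have := noZeroDivisors hC hinf
  have := finiteDimensional_ker_hitRight hC (mul_ne_zero hf hg)
  rw [hitRight_mul] at this ⊢
  exact LinearMap.finrank_ker_comp_of_surjective _ _ (hitRight_surjective hC hinf hf)

/-! ### Every principal one-sided ideal is two-sided -/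

theorem mul_mem_of_forall_apply_eq_zero (hC : IsChainCoalgebra k C) {N : Submodule k C}
    (hN : IsRightCoideal k N) [FiniteDimensional k N] (a : DualAlgebra k C)
    {f : DualAlgebra k C} (hf : ∀ x ∈ N, f x = 0) (x : C) (hx : x ∈ N) : (a * f) x = 0 := by
  rw [← apply_hitRight]
  exact hf _ (map_hitRight_le hC hN a ⟨x, hx, rfl⟩)

theorem mul_mem_of_forall_apply_eq_zero_right {N : Submodule k C}
    (hN : IsRightCoideal k N) (a : DualAlgebra k C)
    {f : DualAlgebra k C} (hf : ∀ x ∈ N, f x = 0) (x : C) (hx : x ∈ N) : (f * a) x = 0 := by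
  rw [← apply_hitLeft]
  exact hf _ ((isRightCoideal_iff N).1 hN a x hx)

/-- `f C*` is the orthogonal of `ker (hitRight f)`, which is stable under the right action of `a`,
so `a * f` vanishes on it too. -/
theorem exists_mul_eq_mul (hC : IsChainCoalgebra k C) {f : DualAlgebra k C} (hf : f ≠ 0)
    (a : DualAlgebra k C) : ∃ b, a * f = f * b := by
  have := finiteDimensional_ker_hitRight hC hf
  rw [exists_eq_mul_iff]
  have hN := isRightCoideal_ker_hitRight f
  exact mul_mem_of_forall_apply_eq_zero hC hN a ((le_ker_hitRight_iff hN f).1 le_rfl)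

/-- Additivity of the kernel dimension gives `a` and `b` kernels of equal dimension, and in a chain
the dimension determines the right coideal. -/
theorem ker_hitRight_eq_of_mul_eq_mul (hC : IsChainCoalgebra k C)
    (hinf : ¬ FiniteDimensional k C) {f a b : DualAlgebra k C} (hf : f ≠ 0)
    (h : a * f = f * b) : LinearMap.ker (hitRight a) = LinearMap.ker (hitRight b) := by
  have := isDomain hC hinf
  by_cases ha : a = 0
  · subst ha
    rw [zero_mul, zero_eq_mul] at h
    rw [h.resolve_left hf]
  · have hb : b ≠ 0 := by
      rintro rfl
      rw [mul_zero] at h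
      exact mul_ne_zero ha hf h
    have := finiteDimensional_ker_hitRight hC ha
    have := finiteDimensional_ker_hitRight hC hb
    apply eq_of_finrank_eq hC (isRightCoideal_ker_hitRight a) (isRightCoideal_ker_hitRight b)
    have h1 := finrank_ker_hitRight_mul hC hinf ha hf
    have h2 := finrank_ker_hitRight_mul hC hinf hf hb
    rw [h] at h1
    omega

/-- Restriction of functionals to a subspace. -/
def restrict (N : Submodule k C) : DualAlgebra k C →ₗ[k] Module.Dual k N :=
  N.subtype.dualMap ∘ₗ (WithConv.linearEquiv k (C →ₗ[k] k)).toLinearMap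

theorem restrict_surjective (N : Submodule k C) : Function.Surjective (restrict (k := k) N) :=
  (LinearMap.dualMap_surjective_of_injective N.injective_subtype).comp
    (WithConv.linearEquiv k (C →ₗ[k] k)).surjective

theorem mem_ker_restrict (N : Submodule k C) (f : DualAlgebra k C) :
    f ∈ LinearMap.ker (restrict N) ↔ ∀ x ∈ N, f x = 0 := by
  rw [LinearMap.mem_ker, LinearMap.ext_iff]
  exact Subtype.forall

/-- The twist `a * f = f * σ a` need not be inverted globally: membership in `C* f` is tested one
`x` with `f ⇀ x = 0` at a time, so it suffices to solve `σ b = a` on a finite-dimensional right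
coideal containing `x`. -/
theorem exists_mul_eq_mul_right (hC : IsChainCoalgebra k C) (hinf : ¬ FiniteDimensional k C)
    {f : DualAlgebra k C} (hf : f ≠ 0) (a : DualAlgebra k C) : ∃ b, f * a = b * f := by
  have := isDomain hC hinf
  choose s hs using exists_mul_eq_mul hC hf
  let σ : DualAlgebra k C →ₗ[k] DualAlgebra k C :=
    { toFun := s
      map_add' := fun a b => mul_left_cancel₀ hf (by rw [← hs, mul_add, ← hs, ← hs, add_mul])
      map_smul' := fun r a => mul_left_cancel₀ hf (by
        rw [← hs, RingHom.id_apply, mul_smul_comm, ← hs, smul_mul_assoc]) }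
  rw [exists_eq_mul_iff']
  intro x hx
  have := finiteDimensional_range_orbitMap (k := k) x
  have hN := isRightCoideal_range_orbitMap (k := k) x
  have hxN := mem_range_orbitMap (k := k) x
  generalize LinearMap.range (orbitMap (k := k) x) = N at *
  -- Since `b` and `σ b` have the same `hitRight` kernel, one vanishes on `N` exactly when the other
  -- does.
  have hσ : Function.Surjective (restrict N ∘ₗ σ) := by
    refine LinearMap.surjective_of_ker_eq (restrict N) _ (restrict_surjective N) ?_
    ext b
    have h1 : b ∈ LinearMap.ker (restrict N) ↔ N ≤ LinearMap.ker b.ofConv :=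
      mem_ker_restrict N b
    have h2 : b ∈ LinearMap.ker (restrict N ∘ₗ σ) ↔ N ≤ LinearMap.ker (s b).ofConv :=
      mem_ker_restrict N (s b)
    rw [h1, h2, ← le_ker_hitRight_iff hN, ← le_ker_hitRight_iff hN,
      ker_hitRight_eq_of_mul_eq_mul hC hinf hf (hs b)]
  obtain ⟨b, hb⟩ := hσ (restrict N a)
  have hab : ∀ y ∈ N, (a - s b) y = 0 := by
    rw [← mem_ker_restrict, LinearMap.mem_ker, map_sub, ← hb]
    exact sub_self _
  -- At `x`, `f * a` agrees with `f * σ b = b * f`, which vanishes there because `f ⇀ x = 0`.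
  have h1 := mul_mem_of_forall_apply_eq_zero hC hN f hab x hxN
  rw [mul_sub, ← hs] at h1
  have h2 : (b * f) x = 0 := by
    rw [← apply_hitLeft, LinearMap.mem_ker.1 hx, map_zero]
  rw [LinearMap.mem_ker]
  have h3 : (f * a) x - (b * f) x = 0 := h1
  rwa [h2, sub_zero] at h3

/-! ### One-sided ideals of the dual algebra -/

theorem exists_eq_mul_or (hC : IsChainCoalgebra k C) (f g : DualAlgebra k C) :
    (∃ a, g = f * a) ∨ ∃ a, f = g * a := by
  have hf := isRightCoideal_ker_hitRight f
  have hg := isRightCoideal_ker_hitRight g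
  rw [exists_eq_mul_iff, exists_eq_mul_iff, ← le_ker_hitRight_iff hf, ← le_ker_hitRight_iff hg]
  exact hC _ _ hf hg

theorem exists_eq_mul_left_of_eq_mul (hC : IsChainCoalgebra k C)
    (hinf : ¬ FiniteDimensional k C) {f g : DualAlgebra k C} (h : ∃ a, g = f * a) :
    ∃ a, g = a * f := by
  obtain ⟨a, rfl⟩ := h
  by_cases hf : f = 0
  · exact ⟨0, by simp [hf]⟩
  · exact exists_mul_eq_mul_right hC hinf hf a

theorem right_total (hC : IsChainCoalgebra k C)
    (I J : Submodule (DualAlgebra k C)ᵐᵒᵖ (DualAlgebra k C)) : I ≤ J ∨ J ≤ I := by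
  refine Submodule.le_total_of_mem_span_singleton (fun f g => ?_) I J
  rcases exists_eq_mul_or hC f g with ⟨a, h⟩ | ⟨a, h⟩
  · exact Or.inl ⟨MulOpposite.op a, h⟩
  · exact Or.inr ⟨MulOpposite.op a, h⟩

theorem left_total (hC : IsChainCoalgebra k C) (hinf : ¬ FiniteDimensional k C)
    (I J : Submodule (DualAlgebra k C) (DualAlgebra k C)) : I ≤ J ∨ J ≤ I :=
  Submodule.le_total_of_mem_span_singleton (fun f g => (exists_eq_mul_or hC f g).imp
    (exists_eq_mul_left_of_eq_mul hC hinf) (exists_eq_mul_left_of_eq_mul hC hinf)) I J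

/-- A nonzero left ideal is generated by any nonzero `f` in it with `ker (hitRight f)` of least
dimension: by the chain condition this kernel lies in that of every other nonzero element. -/
theorem isNoetherian (hC : IsChainCoalgebra k C) (hinf : ¬ FiniteDimensional k C) :
    IsNoetherian (DualAlgebra k C) (DualAlgebra k C) := by
  refine ⟨fun I => ?_⟩
  by_cases hI : ∃ f ∈ I, f ≠ 0
  swap
  · push Not at hI
    rw [(Submodule.eq_bot_iff I).2 hI]
    exact Submodule.fg_bot
  let d : DualAlgebra k C → ℕ := fun f => Module.finrank k (LinearMap.ker (hitRight f))
  obtain ⟨f, ⟨hfI, hf⟩, hmin⟩ := (measure d).wf.has_min {f | f ∈ I ∧ f ≠ 0} hI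
  refine ⟨{f}, ?_⟩
  rw [Finset.coe_singleton]
  refine le_antisymm ((Submodule.span_singleton_le_iff_mem f I).2 hfI) fun g hgI => ?_
  rw [Submodule.mem_span_singleton]
  by_cases hg : g = 0
  · exact ⟨0, by rw [hg, zero_smul]⟩
  have hdim : d f ≤ d g := not_lt.1 (hmin g ⟨hgI, hg⟩)
  have := finiteDimensional_ker_hitRight hC hg
  have := finiteDimensional_ker_hitRight hC hf
  have hkf := isRightCoideal_ker_hitRight f
  have hle : LinearMap.ker (hitRight f) ≤ LinearMap.ker (hitRight g) := by
    rcases hC _ _ hkf (isRightCoideal_ker_hitRight g) with h | h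
    · exact h
    · exact (Submodule.eq_of_le_of_finrank_le h hdim).ge
  rw [le_ker_hitRight_iff hkf, ← exists_eq_mul_iff] at hle
  obtain ⟨a, ha⟩ := exists_eq_mul_left_of_eq_mul hC hinf hle
  exact ⟨a, ha.symm⟩

theorem isLeftNoetherianChainDomain (hC : IsChainCoalgebra k C)
    (hinf : ¬ FiniteDimensional k C) : IsLeftNoetherianChainDomain (DualAlgebra k C) where
  isDomain := isDomain hC hinf
  left_total := left_total hC hinf
  right_total := right_total hC
  left_noetherian := isNoetherian hC hinf

/-! ### Coreflexivity -/

/-- The two-sided ideal of functionals vanishing on a finite-dimensional right coideal. -/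
def annihilator (hC : IsChainCoalgebra k C) {N : Submodule k C} (hN : IsRightCoideal k N)
    [FiniteDimensional k N] : Ideal (DualAlgebra k C) where
  carrier := {f | ∀ x ∈ N, f x = 0}
  zero_mem' _ _ := rfl
  add_mem' {f g} hf hg x hx := by
    change f x + g x = 0
    rw [hf x hx, hg x hx, add_zero]
  smul_mem' a _ hf := mul_mem_of_forall_apply_eq_zero hC hN a hf

theorem finite_quotient_annihilator (hC : IsChainCoalgebra k C) {N : Submodule k C}
    (hN : IsRightCoideal k N) [FiniteDimensional k N] :
    Module.Finite k (DualAlgebra k C ⧸ annihilator hC hN) := by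
  let e : (DualAlgebra k C ⧸ annihilator hC hN) →ₗ[k] Module.Dual k N :=
    ((annihilator hC hN).restrictScalars k).liftQ (restrict N)
      fun f hf => (mem_ker_restrict N f).2 hf
  refine Module.Finite.of_injective e ?_
  rw [← LinearMap.ker_eq_bot, LinearMap.ker_eq_bot']
  intro y hy
  obtain ⟨f, rfl⟩ := Submodule.Quotient.mk_surjective _ y
  rw [Submodule.Quotient.mk_eq_zero]
  exact (mem_ker_restrict N f).1 hy

/-- A linear form on `C*` that vanishes on the orthogonal of a finite-dimensional subspace is
the evaluation at a vector. -/
theorem exists_eq_apply_of_vanishing (N : Submodule k C) [FiniteDimensional k N]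
    (φ : DualAlgebra k C →ₗ[k] k) (h : ∀ f : DualAlgebra k C, (∀ x ∈ N, f x = 0) → φ f = 0) :
    ∃ c : C, ∀ f : DualAlgebra k C, φ f = f c := by
  have : φ ∈ LinearMap.range (restrict N).dualMap := by
    rw [LinearMap.range_dualMap_eq_dualAnnihilator_ker, Submodule.mem_dualAnnihilator]
    exact fun f hf => h f ((mem_ker_restrict N f).1 hf)
  obtain ⟨ψ, rfl⟩ := this
  -- The form factors through `N*`, and `N` is reflexive, being finite-dimensional.
  obtain ⟨x, rfl⟩ := (Module.evalEquiv k N).surjective ψ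
  exact ⟨x, fun f => rfl⟩

theorem evaluation_mem_finiteDual (hC : IsChainCoalgebra k C) (c : C) :
    Module.Dual.eval k C c ∘ₗ (WithConv.linearEquiv k (C →ₗ[k] k)).toLinearMap ∈
      finiteDualSubmodule k (DualAlgebra k C) := by
  have := finiteDimensional_range_orbitMap (k := k) c
  have hN := isRightCoideal_range_orbitMap (k := k) c
  exact ⟨annihilator hC hN, ⟨fun b h => mul_mem_of_forall_apply_eq_zero_right hN b h⟩,
    finite_quotient_annihilator hC hN, fun f hf => hf c (mem_range_orbitMap c)⟩

/-- The evaluation map `C → (C*)°`. -/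
def evaluation (hC : IsChainCoalgebra k C) : C →ₗ[k] FiniteDual k (DualAlgebra k C) :=
  LinearMap.codRestrict (finiteDualSubmodule k (DualAlgebra k C))
    ((WithConv.linearEquiv k (C →ₗ[k] k)).toLinearMap.dualMap ∘ₗ Module.Dual.eval k C)
    (evaluation_mem_finiteDual hC)

/-- The evaluation map as a morphism of coalgebras. -/
def evaluationHom (hC : IsChainCoalgebra k C) : C →ₗc[k] FiniteDual k (DualAlgebra k C) where
  __ := evaluation hC
  counit_comp := rfl
  map_comp_comul := LinearMap.ext fun c => FiniteDual.pair_ext fun f g => by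
    have key : ∀ z : C ⊗[k] C,
        FiniteDual.pair f g (TensorProduct.map (evaluation hC) (evaluation hC) z) =
          LinearMap.mul' k k (TensorProduct.map f.ofConv g.ofConv z) := by
      intro z
      induction z with
      | zero => simp
      | add x y hx hy => simp only [map_add, hx, hy]
      | tmul x y => rfl
    exact (key _).trans (FiniteDual.pair_comulMap f g (evaluation hC c)).symm

theorem evaluation_injective (hC : IsChainCoalgebra k C) :
    Function.Injective (evaluation hC) := fun _ _ h =>
  eq_of_forall_apply_eq fun f => congrArg (fun φ => φ.1 f) h

theorem evaluation_surjective (hC : IsChainCoalgebra k C) (hinf : ¬ FiniteDimensional k C) :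
    Function.Surjective (evaluation hC) := by
  rintro ⟨φ, I, hI, hIf, hφ⟩
  -- The zero ideal has infinite codimension because `C*` is infinite-dimensional.
  obtain ⟨f, hfI, hf⟩ : ∃ f ∈ I, f ≠ 0 := by
    by_contra! h
    obtain rfl := (Submodule.eq_bot_iff I).2 h
    have : Module.Finite k (DualAlgebra k C) :=
      Module.Finite.equiv ((Submodule.quotEquivOfEqBot
        (⊥ : Ideal (DualAlgebra k C)) rfl).restrictScalars k)
    have : Module.Finite k (Module.Dual k C) :=
      Module.Finite.equiv (WithConv.linearEquiv k (C →ₗ[k] k))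
    exact hinf ((Module.finite_dual_iff k).1 this)
  have := finiteDimensional_ker_hitRight hC hf
  obtain ⟨c, hc⟩ := exists_eq_apply_of_vanishing (LinearMap.ker (hitRight f)) φ fun g hg => by
    obtain ⟨a, rfl⟩ := (exists_eq_mul_iff f g).2 hg
    exact hφ _ (hI.mul_mem_of_left a hfI)
  exact ⟨c, Subtype.ext (LinearMap.ext fun g => (hc g).symm)⟩

theorem isCoreflexive (hC : IsChainCoalgebra k C) (hinf : ¬ FiniteDimensional k C) :
    IsCoreflexive k C :=
  ⟨CoalgEquiv.ofBijective (f := evaluationHom hC)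
    ⟨evaluation_injective hC, evaluation_surjective hC hinf⟩, fun _ _ => rfl⟩

end DualAlgebra

end

theorem mainTheorem4 {k C : Type*} [Field k] [AddCommGroup C] [Module k C] [Coalgebra k C]
    (hC : IsChainCoalgebra k C) (hinf : ¬ FiniteDimensional k C) :
    IsCoreflexive k C ∧
      IsLeftNoetherianChainDomain (DualAlgebra k C) ∧
      Nonempty (C ≃ₗc[k] FiniteDual k (DualAlgebra k C)) := by
  have h := DualAlgebra.isCoreflexive hC hinf
  exact ⟨h, DualAlgebra.isLeftNoetherianChainDomain hC hinf, ⟨h.choose⟩⟩
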